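/- For an open set $\Omega\subset\mathbb{C}$ and $\mu>0$, let $C^{\mathrm{Log}^{\mu}L}(\Omega)$ be the space of continuous functions $f:\Omega\to\mathbb{C}$ with $$\|f\|_{C^{\mathrm{Log}^{\mu}L}(\Omega)}:=\sup_{w\in\Omega}|f(w)|+\sup_{w,\,w+h\in\Omega,\ h\neq 0}|f(w+h)-f(w)|\,\bigl|\ln|h|\bigr|^{\mu}<\infty .$$ **Theorem.** Let $\Omega\subset\mathbb{C}$ be a bounded domain (non-empty, open, connected) with $C^{1,\alpha}$ boundary for some $\alpha>0$; that is, near each boundary point, after a rigid motion, $\Omega$ is the region strictly above the graph of a $C^1$ function with $\alpha$-Hölder continuous derivative. Let $\nu>1$. Then for every $f\in C^{\mathrm{Log}^{\nu}L}(\Omega)$ and every $z\in\Omega$ the integral $${}^2Tf(z):=\frac{-1}{2\pi i}\int_\Omega\frac{f(\zeta)-f(z)}{(\zeta-z)^2}\,d\bar\zeta\wedge d\zeta$$ converges absolutely, and ${}^2T$ is a bounded linear operator from $C^{\mathrm{Log}^{\nu}L}(\Omega)$ into $C^{\mathrm{Log}^{\nu-1}L}(\Omega)$: it is linear, and there is a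 constant $C$ depending only on $\Omega$ and $\nu$ such that $\|{}^2Tf\|_{C^{\mathrm{Log}^{\nu-1}L}(\Omega)}\le C\,\|f\|_{C^{\mathrm{Log}^{\nu}L}(\Omega)}$ for all $f\in C^{\mathrm{Log}^{\nu}L}(\Omega)$. -/

import Mathlib

open scoped ENNReal NNReal

noncomputable section

/-- `Ω ⊆ ℂ` has `C^{1,α}` boundary: near every boundary point, after a rigid motion, `Ω` is the
region lying strictly above the graph of a `C¹` function whose derivative is `α`-Hölder. -/
def HasC1HolderBoundary (Ω : Set ℂ) (α : ℝ≥0) : Prop :=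
  ∀ p ∈ frontier Ω, ∃ u : ℂ, ‖u‖ = 1 ∧ ∃ r : ℝ, 0 < r ∧ ∃ φ : ℝ → ℝ,
    ContDiff ℝ 1 φ ∧ (∃ K : ℝ≥0, HolderWith K α (deriv φ)) ∧
    ∀ w : ℂ, ‖w‖ < r → (p + u * w ∈ Ω ↔ φ w.re < w.im)

/-- `sup_{w ∈ Ω} |f(w)| + sup_{w, w' ∈ Ω} |f(w') - f(w)| |ln |w' - w||^ν`, as an extended
nonnegative real. (For `w = w'` the second quantity is `0`.) -/
def eLogNorm {Ω : Set ℂ} (ν : ℝ) (f : Ω → ℂ) : ℝ≥0∞ :=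
  (⨆ w : Ω, ‖f w‖ₑ) +
    ⨆ w : Ω, ⨆ w' : Ω, ‖f w' - f w‖ₑ * ENNReal.ofReal (|Real.log ‖(w' : ℂ) - w‖| ^ ν)

theorem eLogNorm_zero {Ω : Set ℂ} (ν : ℝ) : eLogNorm ν (0 : Ω → ℂ) = 0 := by
  simp [eLogNorm]

theorem eLogNorm_add_le {Ω : Set ℂ} (ν : ℝ) (f g : Ω → ℂ) :
    eLogNorm ν (f + g) ≤ eLogNorm ν f + eLogNorm ν g := by
  unfold eLogNorm
  rw [add_add_add_comm]
  refine add_le_add (iSup_le fun w => ?_) (iSup_le fun w => iSup_le fun w' => ?_)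
  · exact (enorm_add_le _ _).trans
      (add_le_add (le_iSup (fun w => ‖f w‖ₑ) w) (le_iSup (fun w => ‖g w‖ₑ) w))
  · refine le_trans ?_ (add_le_add (le_iSup₂ (f := fun w w' : Ω =>
      ‖f w' - f w‖ₑ * ENNReal.ofReal (|Real.log ‖(w' : ℂ) - w‖| ^ ν)) w w')
      (le_iSup₂ (f := fun w w' : Ω =>
      ‖g w' - g w‖ₑ * ENNReal.ofReal (|Real.log ‖(w' : ℂ) - w‖| ^ ν)) w w'))
    rw [← add_mul]
    gcongr
    have h : (f + g) w' - (f + g) w = (f w' - f w) + (g w' - g w) := by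
      simp only [Pi.add_apply]; ring
    rw [h]
    exact enorm_add_le _ _

theorem eLogNorm_smul {Ω : Set ℂ} (ν : ℝ) (c : ℂ) (f : Ω → ℂ) :
    eLogNorm ν (c • f) = ‖c‖ₑ * eLogNorm ν f := by
  simp only [eLogNorm, mul_add, ENNReal.mul_iSup, Pi.smul_apply, ← smul_sub, enorm_smul, mul_assoc]

/-- The functions of `C^{Log^ν L}(Ω)`: continuous on `Ω`, with finite norm. -/
def logSubmodule (Ω : Set ℂ) (ν : ℝ) : Submodule ℂ (Ω → ℂ) where
  carrier := {f | Continuous f ∧ eLogNorm ν f < ∞}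
  zero_mem' := ⟨continuous_zero, by simp [eLogNorm_zero]⟩
  add_mem' hf hg := ⟨hf.1.add hg.1,
    (eLogNorm_add_le ν _ _).trans_lt (ENNReal.add_lt_top.2 ⟨hf.2, hg.2⟩)⟩
  smul_mem' c _ hf := ⟨hf.1.const_smul c, by
    rw [eLogNorm_smul]; exact ENNReal.mul_lt_top enorm_lt_top hf.2⟩

/-- The space `C^{Log^ν L}(Ω)`. It is a type of its own, so that it carries the topology of its
norm and not that of pointwise convergence. -/
def LogCont (Ω : Set ℂ) (ν : ℝ) : Type := logSubmodule Ω ν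

namespace LogCont

variable {Ω : Set ℂ} {ν : ℝ}

instance : CoeFun (LogCont Ω ν) (fun _ => Ω → ℂ) := ⟨fun f => f.1⟩

instance : AddCommGroup (LogCont Ω ν) := inferInstanceAs (AddCommGroup (logSubmodule Ω ν))

instance : Module ℂ (LogCont Ω ν) := inferInstanceAs (Module ℂ (logSubmodule Ω ν))

instance : Norm (LogCont Ω ν) := ⟨fun f => (eLogNorm ν f).toReal⟩

theorem norm_def (f : LogCont Ω ν) : ‖f‖ = (eLogNorm ν f).toReal := rfl

theorem normCore : NormedSpace.Core ℂ (LogCont Ω ν) where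
  norm_nonneg _ := ENNReal.toReal_nonneg
  norm_smul c f := by
    change (eLogNorm ν (c • f.1)).toReal = ‖c‖ * (eLogNorm ν f.1).toReal
    simp [eLogNorm_smul, ENNReal.toReal_mul]
  norm_triangle f g := by
    change (eLogNorm ν (f.1 + g.1)).toReal ≤ (eLogNorm ν f.1).toReal + (eLogNorm ν g.1).toReal
    rw [← ENNReal.toReal_add f.2.2.ne g.2.2.ne]
    exact ENNReal.toReal_mono (ENNReal.add_lt_top.2 ⟨f.2.2, g.2.2⟩).ne (eLogNorm_add_le ν _ _)
  norm_eq_zero_iff f := by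
    constructor
    · intro h
      have h0 : eLogNorm ν f.1 = 0 :=
        ((ENNReal.toReal_eq_zero_iff _).1 h).resolve_right f.2.2.ne
      refine Subtype.ext (funext fun w => ?_)
      have h1 := (add_eq_zero.1 h0).1
      exact enorm_eq_zero.1 (ENNReal.iSup_eq_zero.1 h1 w)
    · rintro rfl
      change (eLogNorm ν (0 : Ω → ℂ)).toReal = 0
      simp [eLogNorm_zero]

instance : NormedAddCommGroup (LogCont Ω ν) := NormedAddCommGroup.ofCore normCore

instance : NormedSpace ℂ (LogCont Ω ν) := NormedSpace.ofCore normCore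

end LogCont

/-- Lebesgue measure on `Ω ⊆ ℂ`. -/
abbrev areaOn (Ω : Set ℂ) : MeasureTheory.Measure Ω :=
  MeasureTheory.Measure.comap Subtype.val MeasureTheory.volume

/-- The integrand `(f(ζ) - f(z)) / (ζ - z)²`. -/
def nwIntegrand {Ω : Set ℂ} (f : Ω → ℂ) (z : Ω) (ζ : Ω) : ℂ :=
  (f ζ - f z) / ((ζ : ℂ) - (z : ℂ)) ^ 2

/-- The operator `²Tf(z) = -1/(2πi) ∫_Ω (f(ζ) - f(z)) / (ζ - z)² dζ̄ ∧ dζ`, where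
`dζ̄ ∧ dζ = 2i dx ∧ dy` is `2i` times Lebesgue measure. -/
def nijenhuisWoolf {Ω : Set ℂ} (f : Ω → ℂ) (z : Ω) : ℂ :=
  -1 / (2 * Real.pi * Complex.I) *
    ∫ ζ : Ω, nwIntegrand f z ζ * (2 * Complex.I) ∂areaOn Ω

end

/-!
The operator is estimated by absolute values throughout. With `ℓ(t) = ln (e R² / t)`, where `R` is
large compared with the diameter of `Ω`, membership in `C^{Log^ν L}(Ω)` amounts to the single
modulus of continuity `ℓ^(-ν)` (`norm_sub_le_logScale`, `mem_logSubmodule_of_bounds`).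

Since `ν > 1`, the function `ℓ(t)^(-ν) / t` is integrable at `0`, with primitive
`ℓ(t)^(1-ν) / (ν-1)`. In polar coordinates this gives absolute convergence, the bound for the
supremum, and the bound `C ℓ(h)^(1-ν)` for the part of `²Tf(z') - ²Tf(z)`, `h = |z' - z|`, that
comes from the disc `|ζ - z| ≤ 2h`. Outside this disc the difference of the integrands is
`(f(ζ) - f(z)) (1/(ζ-z')² - 1/(ζ-z)²) - (f(z') - f(z)) / (ζ-z')²`. The first term is at most a
multiple of `ℓ(|ζ-z|)^(-ν) h / |ζ-z|³`, hence of `ℓ(h)^(-ν) / |ζ-z|²`, because `ℓ` grows more slowly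
than any power (`logScale_rpow_neg_mul_div_le`); the second is trivially of the same size. The
integral of `1 / |ζ-z|²` over `h < |ζ-z| ≤ R` costs one logarithm `ℓ(h)`, which is exactly the
power lost in the theorem (`norm_nijenhuisWoolf_sub_le`).
-/

open MeasureTheory Set

/-! ### A logarithmic scale which is at least one on the domain -/

/-- The scale `ln (e R² / t)`, used in place of the weight `|ln t|`, which vanishes at `t = 1`.
For `R ≥ 1` and `0 < t ≤ R` it is at least `1`, dominates `|ln t|`, and decreases in `t`.
At `t = 0` its value is `0`, by the conventions for division and logarithm. -/
noncomputable def logScale (R t : ℝ) : ℝ := Real.log (Real.exp 1 * R ^ 2 / t)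

section LogScale

variable {R t s : ℝ}

theorem logScale_eq (hR : 0 < R) (ht : 0 < t) :
    logScale R t = 1 + 2 * Real.log R - Real.log t := by
  rw [logScale, Real.log_div (by positivity) ht.ne', Real.log_mul (by positivity) (by positivity),
    Real.log_exp, Real.log_pow]
  norm_num

theorem one_le_logScale (hR : 1 ≤ R) (ht : 0 < t) (htR : t ≤ R) : 1 ≤ logScale R t := by
  rw [logScale_eq (by linarith) ht]
  have := Real.log_nonneg hR
  have := Real.log_le_log ht htR
  linarith

theorem abs_log_le_logScale (hR : 1 ≤ R) (ht : 0 < t) (htR : t ≤ R) :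
    |Real.log t| ≤ logScale R t := by
  rw [logScale_eq (by linarith) ht]
  have := Real.log_nonneg hR
  have := Real.log_le_log ht htR
  rw [abs_le]
  constructor <;> linarith

theorem logScale_le_mul (hR : 1 ≤ R) (ht : 0 < t) (hts : t ≤ s) (hsR : s ≤ R) :
    logScale R t ≤ (1 + Real.log (s / t)) * logScale R s := by
  have hs : 0 < s := ht.trans_le hts
  have h1 := one_le_logScale hR hs hsR
  have h2 : 0 ≤ Real.log (s / t) := Real.log_nonneg ((one_le_div ht).2 hts)
  have h3 : logScale R t = logScale R s + Real.log (s / t) := by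
    rw [logScale_eq (by linarith) ht, logScale_eq (by linarith) hs, Real.log_div hs.ne' ht.ne']
    ring
  nlinarith

/-- The scale decays so slowly that one factor `t / s` absorbs the change of `logScale ^ (-ν)`
between `t` and `s`. -/
theorem logScale_rpow_neg_mul_div_le {ν : ℝ} (hν : 0 < ν) (hR : 1 ≤ R) (ht : 0 < t)
    (hts : t ≤ s) (hsR : s ≤ R) :
    logScale R s ^ (-ν) * (t / s) ≤ (1 + ν) ^ ν * logScale R t ^ (-ν) := by
  have hs : 0 < s := ht.trans_le hts
  have h1 := one_le_logScale hR hs hsR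
  have h2 := one_le_logScale hR ht (hts.trans hsR)
  have hx : 1 ≤ s / t := (one_le_div ht).2 hts
  have h4 : 1 + Real.log (s / t) ≤ (1 + ν) * (s / t) ^ (1 / ν) := by
    have h5 := Real.log_le_rpow_div (x := s / t) (by positivity) (one_div_pos.2 hν)
    have h6 := Real.one_le_rpow hx (one_div_pos.2 hν).le
    have h7 : (s / t) ^ (1 / ν) / (1 / ν) = ν * (s / t) ^ (1 / ν) := by field_simp
    linarith
  have h8 : logScale R t ^ ν ≤ (1 + ν) ^ ν * (s / t) * logScale R s ^ ν := by
    calc logScale R t ^ ν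
        ≤ ((1 + ν) * (s / t) ^ (1 / ν) * logScale R s) ^ ν := by
          refine Real.rpow_le_rpow (by linarith) ?_ hν.le
          exact (logScale_le_mul hR ht hts hsR).trans
            (mul_le_mul_of_nonneg_right h4 (by linarith))
      _ = _ := by
          rw [Real.mul_rpow (by positivity) (by linarith),
            Real.mul_rpow (by positivity) (by positivity), ← Real.rpow_mul (by positivity),
            one_div_mul_cancel hν.ne', Real.rpow_one]
  have h9 : 0 < logScale R s ^ ν := Real.rpow_pos_of_pos (by linarith) _
  have h10 : 0 < logScale R t ^ ν := Real.rpow_pos_of_pos (by linarith) _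
  rw [Real.rpow_neg (by linarith), Real.rpow_neg (by linarith), ← div_eq_mul_inv,
    le_div_iff₀ h10]
  calc _ ≤ (logScale R s ^ ν)⁻¹ * (t / s) * ((1 + ν) ^ ν * (s / t) * logScale R s ^ ν) := by
        gcongr
    _ = (1 + ν) ^ ν := by field_simp

theorem logScale_rpow_neg_three_mul_le {p : ℝ} (hp : 0 ≤ p) (hR : 1 ≤ R) (ht : 0 < t)
    (htR : 3 * t ≤ R) : logScale R (3 * t) ^ (-p) ≤ 3 ^ p * logScale R t ^ (-p) := by
  have h1 := one_le_logScale hR (by positivity) htR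
  have h2 := one_le_logScale hR ht (by linarith)
  have h3 : logScale R t ≤ 3 * logScale R (3 * t) := by
    refine (logScale_le_mul hR ht (by linarith) htR).trans ?_
    have : 3 * t / t = 3 := by field_simp
    rw [this]
    have := Real.log_le_sub_one_of_pos (x := 3) (by norm_num)
    gcongr
    linarith
  have h4 : logScale R t ^ p ≤ 3 ^ p * logScale R (3 * t) ^ p := by
    rw [← Real.mul_rpow (by norm_num) (by linarith)]
    exact Real.rpow_le_rpow (by linarith) h3 hp
  have h9 : 0 < logScale R (3 * t) ^ p := Real.rpow_pos_of_pos (by linarith) _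
  have h10 : 0 < logScale R t ^ p := Real.rpow_pos_of_pos (by linarith) _
  rw [Real.rpow_neg (by linarith), Real.rpow_neg (by linarith), ← div_eq_mul_inv,
    le_div_iff₀ h10]
  calc _ ≤ (logScale R (3 * t) ^ p)⁻¹ * (3 ^ p * logScale R (3 * t) ^ p) := by gcongr
    _ = 3 ^ p := by field_simp

theorem hasDerivAt_logScale_rpow {ν : ℝ} (hν : 1 < ν) (hR : 1 ≤ R) (ht : 0 < t) (htR : t ≤ R) :
    HasDerivAt (fun t => logScale R t ^ (1 - ν) / (ν - 1)) (logScale R t ^ (-ν) / t) t := by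
  have h1 := one_le_logScale hR ht htR
  have h2 : HasDerivAt (fun t => logScale R t) (-t⁻¹) t := by
    have h3 : HasDerivAt (fun t => 1 + 2 * Real.log R - Real.log t) (-t⁻¹) t := by
      simpa using (Real.hasDerivAt_log ht.ne').const_sub (1 + 2 * Real.log R)
    refine h3.congr_of_eventuallyEq ?_
    filter_upwards [lt_mem_nhds ht] with x hx
    exact logScale_eq (by linarith) hx
  refine ((h2.rpow_const (p := 1 - ν) (Or.inl (by linarith))).div_const (ν - 1)).congr_deriv ?_
  have h4 : ν - 1 ≠ 0 := by linarith
  rw [show 1 - ν - 1 = -ν by ring]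
  field_simp
  ring

theorem tendsto_logScale_rpow {p : ℝ} (hp : 0 < p) (hR : 1 ≤ R) :
    Filter.Tendsto (fun t => logScale R t ^ (-p)) (nhdsWithin 0 (Ioi 0)) (nhds 0) := by
  refine (tendsto_rpow_neg_atTop hp).comp ?_
  refine Real.tendsto_log_atTop.comp ?_
  change Filter.Tendsto (fun t => Real.exp 1 * R ^ 2 * t⁻¹) _ _
  exact Filter.Tendsto.const_mul_atTop (by positivity) tendsto_inv_nhdsGT_zero

theorem continuousOn_logScale_rpow {ν ρ : ℝ} (hν : 1 < ν) (hR : 1 ≤ R) (hρ : ρ ≤ R) :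
    ContinuousOn (fun t => logScale R t ^ (1 - ν) / (ν - 1)) (Icc 0 ρ) := by
  intro x hx
  rcases hx.1.eq_or_lt with rfl | h0
  · -- Both the limit at `0` and the conventional value `0 ^ (1 - ν)` are `0`.
    refine ContinuousWithinAt.mono ?_ Icc_subset_Ici_self
    rw [← continuousWithinAt_Ioi_iff_Ici, ContinuousWithinAt]
    have h := (tendsto_logScale_rpow (p := ν - 1) (by linarith) hR).div_const (ν - 1)
    simpa [logScale, Real.zero_rpow (show 1 - ν ≠ 0 by linarith)] using h
  · exact (hasDerivAt_logScale_rpow hν hR h0 (hx.2.trans hρ)).continuousAt.continuousWithinAt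

end LogScale

/-! ### Radial integrals over planar domains -/

/-- Integration in polar coordinates, with the radial integral evaluated by a primitive. -/
theorem integral_radial {a b : ℝ} (ha : 0 ≤ a) (hab : a ≤ b) {G G' : ℝ → ℝ}
    (hG : ContinuousOn G (Icc a b)) (hG' : ∀ t ∈ Ioo a b, HasDerivAt G (G' t) t)
    (hpos : ∀ t ∈ Ioo a b, 0 ≤ G' t) :
    Integrable (fun x : ℂ => (Ioc a b).indicator (fun t => G' t / t) ‖x‖) ∧
      ∫ x : ℂ, (Ioc a b).indicator (fun t => G' t / t) ‖x‖ = 2 * Real.pi * (G b - G a) := by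
  have h1 : IntegrableOn G' (Ioc a b) := intervalIntegral.integrableOn_deriv_of_nonneg hG hG' hpos
  have h2 : ∀ y ∈ Ioi (0 : ℝ), y ^ (Module.finrank ℝ ℂ - 1) •
      (Ioc a b).indicator (fun t => G' t / t) y = (Ioc a b).indicator G' y := by
    intro y (hy : 0 < y)
    by_cases h : y ∈ Ioc a b
    · simp [h, Complex.finrank_real_complex]
      field_simp
    · simp [h]
  have h3 : Ioc a b ⊆ Ioi 0 := fun y hy => ha.trans_lt hy.1
  constructor
  · rw [integrable_fun_norm_addHaar volume (f := (Ioc a b).indicator (fun t => G' t / t)),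
      integrableOn_congr_fun h2 measurableSet_Ioi]
    exact ((integrable_indicator_iff measurableSet_Ioc).2 h1).integrableOn
  · rw [integral_fun_norm_addHaar volume ((Ioc a b).indicator (fun t => G' t / t)),
      setIntegral_congr_fun measurableSet_Ioi h2, setIntegral_indicator measurableSet_Ioc,
      inter_eq_right.2 h3, ← intervalIntegral.integral_of_le hab,
      intervalIntegral.integral_eq_sub_of_hasDerivAt_of_le hab hG hG'
        ((intervalIntegrable_iff_integrableOn_Ioc_of_le hab).2 h1)]
    simp [Complex.finrank_real_complex, measureReal_def, Complex.volume_ball]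
    ring

variable {Ω : Set ℂ}

theorem integrable_radial_areaOn (hΩ : MeasurableSet Ω) {k : ℝ → ℝ}
    (hk : Integrable fun x : ℂ => k ‖x‖) (z : ℂ) :
    Integrable (fun ζ : Ω => k ‖(ζ : ℂ) - z‖) (areaOn Ω) := by
  have h := (hk.comp_sub_right z).integrableOn (s := Ω)
  exact (integrableOn_iff_comap_subtypeVal hΩ).1 h

theorem integral_radial_areaOn_le (hΩ : MeasurableSet Ω) {k : ℝ → ℝ}
    (hk : Integrable fun x : ℂ => k ‖x‖) (hk0 : ∀ t, 0 ≤ k t) (z : ℂ) :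
    ∫ ζ : Ω, k ‖(ζ : ℂ) - z‖ ∂areaOn Ω ≤ ∫ x : ℂ, k ‖x‖ := by
  rw [integral_subtype_comap hΩ fun ζ => k ‖ζ - z‖,
    ← integral_sub_right_eq_self (fun x : ℂ => k ‖x‖) z]
  exact setIntegral_le_integral (hk.comp_sub_right z) (Filter.Eventually.of_forall fun _ => hk0 _)

/-- The kernel `ln(eR²/t)^(-ν) / t²` cut off at radius `ρ`, which majorizes the integrand of the
operator on the disc of radius `ρ` about the singularity. -/
noncomputable def discKernel (R ν ρ : ℝ) : ℝ → ℝ :=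
  (Ioc 0 ρ).indicator fun t => logScale R t ^ (-ν) / t / t

/-- The kernel `1 / t²` on the annulus `a < t ≤ R`. -/
noncomputable def annulusKernel (R a : ℝ) : ℝ → ℝ := (Ioc a R).indicator fun t => t⁻¹ / t

section Kernels

variable {R ν ρ h : ℝ}

theorem discKernel_nonneg (hR : 1 ≤ R) (hρ : ρ ≤ R) (t : ℝ) : 0 ≤ discKernel R ν ρ t := by
  refine indicator_nonneg (fun t ht => ?_) t
  have := one_le_logScale hR ht.1 (ht.2.trans hρ)
  have := ht.1
  positivity

theorem annulusKernel_nonneg (ha : 0 ≤ h) (t : ℝ) : 0 ≤ annulusKernel R h t := by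
  refine indicator_nonneg (fun t ht => ?_) t
  have := ha.trans_lt ht.1
  positivity

theorem integral_discKernel (hν : 1 < ν) (hR : 1 ≤ R) (hρ0 : 0 ≤ ρ) (hρ : ρ ≤ R) :
    Integrable (fun x : ℂ => discKernel R ν ρ ‖x‖) ∧
      ∫ x : ℂ, discKernel R ν ρ ‖x‖ = 2 * Real.pi * (logScale R ρ ^ (1 - ν) / (ν - 1)) := by
  have h := integral_radial le_rfl hρ0 (continuousOn_logScale_rpow hν hR hρ)
    (fun t ht => hasDerivAt_logScale_rpow hν hR ht.1 (ht.2.le.trans hρ))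
    (fun t ht => by
      have := one_le_logScale hR ht.1 (ht.2.le.trans hρ)
      have := ht.1
      positivity)
  have h0 : logScale R 0 ^ (1 - ν) / (ν - 1) = 0 := by
    simp [logScale, Real.zero_rpow (show 1 - ν ≠ 0 by linarith)]
  rwa [h0, sub_zero] at h

theorem integral_annulusKernel (hR : 1 ≤ R) (h0 : 0 < h) (hhR : h ≤ R) :
    Integrable (fun x : ℂ => annulusKernel R h ‖x‖) ∧
      ∫ x : ℂ, annulusKernel R h ‖x‖ ≤ 2 * Real.pi * logScale R h := by
  obtain ⟨h1, h2⟩ := integral_radial (G := Real.log) (G' := fun t => t⁻¹) h0.le hhR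
    (Real.continuousOn_log.mono fun t ht => (h0.trans_le ht.1).ne')
    (fun t ht => Real.hasDerivAt_log (h0.trans ht.1).ne')
    (fun t ht => inv_nonneg.2 (h0.trans ht.1).le)
  refine ⟨h1, ?_⟩
  unfold annulusKernel
  rw [h2, logScale_eq (by linarith) h0]
  have := Real.log_nonneg hR
  gcongr
  linarith

end Kernels

/-! ### Estimates for the operator -/

section Estimates

variable {R ν M : ℝ} {f : Ω → ℂ}

/-- A function of `C^{Log^ν L}` has modulus of continuity `C ln(eR²/t)^(-ν)` on all of `Ω`; at
distances near `1`, where the weight `|ln t|^ν` is useless, the supremum norm takes over. -/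
theorem norm_sub_le_logScale (hν : 0 < ν) (hR : 1 ≤ R) (f : LogCont Ω ν) {w w' : Ω}
    (hne : w ≠ w') (hw : ‖(w' : ℂ) - w‖ ≤ R) :
    ‖f w' - f w‖ ≤ 2 * (2 + 2 * Real.log R) ^ ν * ‖f‖ * logScale R ‖(w' : ℂ) - w‖ ^ (-ν) := by
  have hsup : ∀ v, ‖f v‖ ≤ ‖f‖ := fun v => by
    rw [LogCont.norm_def, ← toReal_enorm]
    exact ENNReal.toReal_mono f.2.2.ne ((le_iSup (fun w => ‖f w‖ₑ) v).trans le_self_add)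
  have hlog : ‖f w' - f w‖ * |Real.log ‖(w' : ℂ) - w‖| ^ ν ≤ ‖f‖ := by
    have h1 := ENNReal.toReal_mono f.2.2.ne ((le_iSup₂ (f := fun w w' : Ω =>
      ‖f w' - f w‖ₑ * ENNReal.ofReal (|Real.log ‖(w' : ℂ) - w‖| ^ ν)) w w').trans le_add_self)
    rwa [ENNReal.toReal_mul, toReal_enorm, ENNReal.toReal_ofReal (by positivity)] at h1
  have ht : 0 < ‖(w' : ℂ) - w‖ :=
    norm_pos_iff.2 (sub_ne_zero.2 fun h => hne (Subtype.ext h.symm))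
  set t := ‖(w' : ℂ) - w‖
  have hl := one_le_logScale hR ht hw
  have hlR := Real.log_nonneg hR
  have hN := norm_nonneg f
  have hpow : 0 < logScale R t ^ ν := Real.rpow_pos_of_pos (by linarith) _
  rw [Real.rpow_neg (by linarith), ← div_eq_mul_inv, le_div_iff₀ hpow]
  rcases le_total (Real.log t) (-1) with h | h
  · have h1 : logScale R t ^ ν ≤ (2 + 2 * Real.log R) ^ ν * |Real.log t| ^ ν := by
      rw [← Real.mul_rpow (by positivity) (by positivity)]
      refine Real.rpow_le_rpow (by linarith) ?_ hν.le
      rw [logScale_eq (by linarith) ht, abs_of_nonpos (by linarith)]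
      nlinarith
    calc _ ≤ ‖f w' - f w‖ * ((2 + 2 * Real.log R) ^ ν * |Real.log t| ^ ν) := by gcongr
      _ = (2 + 2 * Real.log R) ^ ν * (‖f w' - f w‖ * |Real.log t| ^ ν) := by ring
      _ ≤ (2 + 2 * Real.log R) ^ ν * ‖f‖ := by gcongr
      _ ≤ _ := by
          have : 0 ≤ (2 + 2 * Real.log R) ^ ν * ‖f‖ := by positivity
          linarith
  · have h1 : logScale R t ^ ν ≤ (2 + 2 * Real.log R) ^ ν := by
      refine Real.rpow_le_rpow (by linarith) ?_ hν.le
      rw [logScale_eq (by linarith) ht]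
      linarith
    have h2 : ‖f w' - f w‖ ≤ 2 * ‖f‖ := by
      linarith [norm_sub_le (f w') (f w), hsup w, hsup w']
    calc _ ≤ 2 * ‖f‖ * (2 + 2 * Real.log R) ^ ν := by gcongr
      _ = _ := by ring

theorem norm_nwIntegrand_le {ρ : ℝ} (hR : 1 ≤ R) (hρ : ρ ≤ R) (hM : 0 ≤ M)
    (hf : ∀ w w' : Ω, w ≠ w' → ‖f w' - f w‖ ≤ M * logScale R ‖(w' : ℂ) - w‖ ^ (-ν))
    {z ζ : Ω} (h : ‖(ζ : ℂ) - z‖ ≤ ρ) :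
    ‖nwIntegrand f z ζ‖ ≤ M * discKernel R ν ρ ‖(ζ : ℂ) - z‖ := by
  rcases eq_or_ne z ζ with rfl | hne
  · simpa [nwIntegrand] using mul_nonneg hM (discKernel_nonneg hR hρ _)
  have ht : 0 < ‖(ζ : ℂ) - z‖ :=
    norm_pos_iff.2 (sub_ne_zero.2 fun h => hne (Subtype.ext h.symm))
  rw [discKernel, indicator_of_mem (show ‖(ζ : ℂ) - z‖ ∈ Ioc 0 ρ from ⟨ht, h⟩), nwIntegrand,
    norm_div, norm_pow, div_div, ← pow_two, ← mul_div_assoc]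
  gcongr
  exact hf z ζ hne

theorem integrable_nwIntegrand (hΩ : MeasurableSet Ω) (hν : 1 < ν) (hR : 1 ≤ R) (hM : 0 ≤ M)
    (hD : ∀ w w' : Ω, 3 * ‖(w' : ℂ) - w‖ ≤ R) (hc : Continuous f)
    (hf : ∀ w w' : Ω, w ≠ w' → ‖f w' - f w‖ ≤ M * logScale R ‖(w' : ℂ) - w‖ ^ (-ν)) (z : Ω) :
    Integrable (nwIntegrand f z) (areaOn Ω) := by
  have h1 := (integral_discKernel hν hR (by linarith) le_rfl).1
  refine ((integrable_radial_areaOn hΩ h1 z).const_mul M).mono' ?_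
    (Filter.Eventually.of_forall fun ζ => norm_nwIntegrand_le hR le_rfl hM hf ?_)
  · have : Measurable (nwIntegrand f z) :=
      (hc.measurable.sub_const _).div ((measurable_subtype_coe.sub_const _).pow_const 2)
    exact this.aestronglyMeasurable
  · linarith [hD z ζ, norm_nonneg ((ζ : ℂ) - z)]

theorem nijenhuisWoolf_eq (f : Ω → ℂ) (z : Ω) :
    nijenhuisWoolf f z = -(Real.pi : ℂ)⁻¹ * ∫ ζ : Ω, nwIntegrand f z ζ ∂areaOn Ω := by
  rw [nijenhuisWoolf, integral_mul_const]
  have : (Real.pi : ℂ) ≠ 0 := by exact_mod_cast Real.pi_ne_zero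
  field_simp

theorem norm_nijenhuisWoolf_le (hΩ : MeasurableSet Ω) (hν : 1 < ν) (hR : 1 ≤ R) (hM : 0 ≤ M)
    (hD : ∀ w w' : Ω, 3 * ‖(w' : ℂ) - w‖ ≤ R)
    (hf : ∀ w w' : Ω, w ≠ w' → ‖f w' - f w‖ ≤ M * logScale R ‖(w' : ℂ) - w‖ ^ (-ν)) (z : Ω) :
    ‖nijenhuisWoolf f z‖ ≤ 2 / (ν - 1) * M := by
  obtain ⟨h1, h2⟩ := integral_discKernel hν hR (by linarith) le_rfl
  have h3 : ‖∫ ζ : Ω, nwIntegrand f z ζ ∂areaOn Ω‖ ≤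
      ∫ ζ : Ω, M * discKernel R ν R ‖(ζ : ℂ) - z‖ ∂areaOn Ω :=
    norm_integral_le_of_norm_le ((integrable_radial_areaOn hΩ h1 z).const_mul M)
      (Filter.Eventually.of_forall fun ζ => norm_nwIntegrand_le hR le_rfl hM hf
        (by linarith [hD z ζ, norm_nonneg ((ζ : ℂ) - z)]))
  rw [integral_const_mul] at h3
  have h4 := integral_radial_areaOn_le hΩ h1 (discKernel_nonneg hR le_rfl) z
  have h5 : logScale R R ^ (1 - ν) ≤ 1 :=
    Real.rpow_le_one_of_one_le_of_nonpos (one_le_logScale hR (by linarith) le_rfl) (by linarith)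
  have hν' : 0 < ν - 1 := by linarith
  rw [nijenhuisWoolf_eq, norm_mul, norm_neg, norm_inv, Complex.norm_real, Real.norm_of_nonneg
    Real.pi_pos.le]
  calc _ ≤ Real.pi⁻¹ * (M * (2 * Real.pi * (1 / (ν - 1)))) := by
        refine mul_le_mul_of_nonneg_left (h3.trans ?_) (by positivity)
        refine mul_le_mul_of_nonneg_left ((h4.trans_eq h2).trans ?_) hM
        gcongr
    _ = _ := by field_simp

/-- Difference of the integrands away from both singularities. Both the difference of the kernels
and the difference `f z' - f z` contribute `ln(eR²/|z' - z|)^(-ν) / |ζ - z|²`. -/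
theorem norm_nwIntegrand_sub_le_of_lt (hν : 0 < ν) (hR : 1 ≤ R) (hM : 0 ≤ M)
    (hD : ∀ w w' : Ω, 3 * ‖(w' : ℂ) - w‖ ≤ R)
    (hf : ∀ w w' : Ω, w ≠ w' → ‖f w' - f w‖ ≤ M * logScale R ‖(w' : ℂ) - w‖ ^ (-ν))
    {z z' ζ : Ω} (hne : z ≠ z') (h : 2 * ‖(z' : ℂ) - z‖ < ‖(ζ : ℂ) - z‖) :
    ‖nwIntegrand f z' ζ - nwIntegrand f z ζ‖ ≤
      M * (10 * (1 + ν) ^ ν + 4) * logScale R ‖(z' : ℂ) - z‖ ^ (-ν) *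
        annulusKernel R ‖(z' : ℂ) - z‖ ‖(ζ : ℂ) - z‖ := by
  have hd : 0 < ‖(z' : ℂ) - z‖ :=
    norm_pos_iff.2 (sub_ne_zero.2 fun h => hne (Subtype.ext h.symm))
  have ht : 0 < ‖(ζ : ℂ) - z‖ := by linarith
  have hneζ : z ≠ ζ := by
    rintro rfl
    simp at ht
  have htR : ‖(ζ : ℂ) - z‖ ≤ R := by linarith [hD z ζ]
  have hs1 : ‖(ζ : ℂ) - z‖ ≤ ‖(ζ : ℂ) - z'‖ + ‖(z' : ℂ) - z‖ := by
    simpa using norm_add_le ((ζ : ℂ) - z') (z' - z)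
  have hs2 : ‖(ζ : ℂ) - z'‖ ≤ ‖(ζ : ℂ) - z‖ + ‖(z' : ℂ) - z‖ := by
    simpa using norm_sub_le ((ζ : ℂ) - z) (z' - z)
  have hfz := hf z z' hne
  have hfζ := hf z ζ hneζ
  have habsorb := logScale_rpow_neg_mul_div_le hν hR hd (by linarith) htR
  rw [annulusKernel, indicator_of_mem
    (show ‖(ζ : ℂ) - z‖ ∈ Ioc ‖(z' : ℂ) - z‖ R from ⟨by linarith, htR⟩)]
  have ha0 : (ζ : ℂ) - z ≠ 0 := norm_pos_iff.1 ht
  have hb0 : (ζ : ℂ) - z' ≠ 0 := norm_pos_iff.1 (by linarith)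
  have hkey : nwIntegrand f z' ζ - nwIntegrand f z ζ =
      (f ζ - f z) * ((z' - z) * ((ζ - z) + (ζ - z')) / ((ζ - z) ^ 2 * (ζ - z') ^ 2)) -
        (f z' - f z) / ((ζ : ℂ) - z') ^ 2 := by
    rw [nwIntegrand, nwIntegrand]
    field_simp
    ring
  have hadd := norm_add_le ((ζ : ℂ) - z) (ζ - z')
  rw [hkey]
  refine (norm_sub_le _ _).trans ?_
  rw [norm_mul, norm_div, norm_div, norm_mul, norm_mul, norm_pow, norm_pow]
  set t := ‖(ζ : ℂ) - z‖
  set s := ‖(ζ : ℂ) - z'‖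
  set d := ‖(z' : ℂ) - z‖
  have hst : t / 2 ≤ s := by linarith
  have hs : 0 < s := by linarith
  have hq : t ^ 2 / 4 ≤ s ^ 2 := by nlinarith
  have hk : d * ‖(ζ : ℂ) - z + (ζ - z')‖ / (t ^ 2 * s ^ 2) ≤ 10 * (d / t) * (t⁻¹ / t) := by
    calc _ ≤ d * (5 / 2 * t) / (t ^ 2 * (t ^ 2 / 4)) := by
          gcongr
          linarith
      _ = _ := by field_simp; ring
  have hlogt : 0 ≤ logScale R t := zero_le_one.trans (one_le_logScale hR ht htR)
  have hlogd : 0 ≤ logScale R d :=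
    zero_le_one.trans (one_le_logScale hR hd (by linarith))
  have hA : ‖f ζ - f z‖ * (d * ‖(ζ : ℂ) - z + (ζ - z')‖ / (t ^ 2 * s ^ 2)) ≤
      M * (10 * (1 + ν) ^ ν) * logScale R d ^ (-ν) * (t⁻¹ / t) := by
    calc _ ≤ M * logScale R t ^ (-ν) * (10 * (d / t) * (t⁻¹ / t)) := by gcongr
      _ = 10 * M * (t⁻¹ / t) * (logScale R t ^ (-ν) * (d / t)) := by ring
      _ ≤ 10 * M * (t⁻¹ / t) * ((1 + ν) ^ ν * logScale R d ^ (-ν)) := by gcongr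
      _ = _ := by ring
  have hB : ‖f z' - f z‖ / s ^ 2 ≤ M * 4 * logScale R d ^ (-ν) * (t⁻¹ / t) := by
    calc _ ≤ M * logScale R d ^ (-ν) / (t ^ 2 / 4) := by gcongr
      _ = _ := by field_simp
  linarith

theorem norm_nwIntegrand_sub_le (hν : 1 < ν) (hR : 1 ≤ R) (hM : 0 ≤ M)
    (hD : ∀ w w' : Ω, 3 * ‖(w' : ℂ) - w‖ ≤ R)
    (hf : ∀ w w' : Ω, w ≠ w' → ‖f w' - f w‖ ≤ M * logScale R ‖(w' : ℂ) - w‖ ^ (-ν))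
    {z z' : Ω} (hne : z ≠ z') (ζ : Ω) :
    ‖nwIntegrand f z' ζ - nwIntegrand f z ζ‖ ≤
      M * discKernel R ν (3 * ‖(z' : ℂ) - z‖) ‖(ζ : ℂ) - z'‖ +
      M * discKernel R ν (3 * ‖(z' : ℂ) - z‖) ‖(ζ : ℂ) - z‖ +
      M * (10 * (1 + ν) ^ ν + 4) * logScale R ‖(z' : ℂ) - z‖ ^ (-ν) *
        annulusKernel R ‖(z' : ℂ) - z‖ ‖(ζ : ℂ) - z‖ := by
  have hd : 0 < ‖(z' : ℂ) - z‖ :=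
    norm_pos_iff.2 (sub_ne_zero.2 fun h => hne (Subtype.ext h.symm))
  have hρ : 3 * ‖(z' : ℂ) - z‖ ≤ R := hD z z'
  have h1 := mul_nonneg hM (discKernel_nonneg (ν := ν) hR hρ ‖(ζ : ℂ) - z'‖)
  have h2 := mul_nonneg hM (discKernel_nonneg (ν := ν) hR hρ ‖(ζ : ℂ) - z‖)
  rcases lt_or_ge (2 * ‖(z' : ℂ) - z‖) ‖(ζ : ℂ) - z‖ with h | h
  · linarith [norm_nwIntegrand_sub_le_of_lt (by linarith) hR hM hD hf hne h]
  · have hs2 : ‖(ζ : ℂ) - z'‖ ≤ ‖(ζ : ℂ) - z‖ + ‖(z' : ℂ) - z‖ := by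
      simpa using norm_sub_le ((ζ : ℂ) - z) (z' - z)
    have h3 := norm_nwIntegrand_le hR hρ hM hf (z := z') (ζ := ζ) (by linarith)
    have h4 := norm_nwIntegrand_le hR hρ hM hf (z := z) (ζ := ζ) (by linarith)
    have h5 : 0 ≤ M * (10 * (1 + ν) ^ ν + 4) * logScale R ‖(z' : ℂ) - z‖ ^ (-ν) *
        annulusKernel R ‖(z' : ℂ) - z‖ ‖(ζ : ℂ) - z‖ := by
      have h6 := annulusKernel_nonneg (R := R) hd.le ‖(ζ : ℂ) - z‖
      have h7 := one_le_logScale hR hd (by linarith)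
      positivity
    linarith [norm_sub_le (nwIntegrand f z' ζ) (nwIntegrand f z ζ)]

/-- The modulus of continuity of `²Tf`. One power of the logarithm is lost: in the disc, to
`∫ ln(eR²/t)^(-ν) dt/t`; in the annulus, to `∫ dt/t`. -/
theorem norm_nijenhuisWoolf_sub_le (hΩ : MeasurableSet Ω) (hν : 1 < ν) (hR : 1 ≤ R) (hM : 0 ≤ M)
    (hD : ∀ w w' : Ω, 3 * ‖(w' : ℂ) - w‖ ≤ R) (hc : Continuous f)
    (hf : ∀ w w' : Ω, w ≠ w' → ‖f w' - f w‖ ≤ M * logScale R ‖(w' : ℂ) - w‖ ^ (-ν))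
    {z z' : Ω} (hne : z ≠ z') :
    ‖nijenhuisWoolf f z' - nijenhuisWoolf f z‖ ≤
      (4 * 3 ^ (ν - 1) / (ν - 1) + 2 * (10 * (1 + ν) ^ ν + 4)) * M *
        logScale R ‖(z' : ℂ) - z‖ ^ (-(ν - 1)) := by
  have hd : 0 < ‖(z' : ℂ) - z‖ :=
    norm_pos_iff.2 (sub_ne_zero.2 fun h => hne (Subtype.ext h.symm))
  have hρ : 3 * ‖(z' : ℂ) - z‖ ≤ R := hD z z'
  have hpt := norm_nwIntegrand_sub_le hν hR hM hD hf hne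
  set d := ‖(z' : ℂ) - z‖
  set K := 10 * (1 + ν) ^ ν + 4
  have hν' : 0 < ν - 1 := by linarith
  have hl := one_le_logScale hR hd (by linarith)
  obtain ⟨h1, h2⟩ := integral_discKernel hν hR (by positivity) hρ
  obtain ⟨h3, h4⟩ := integral_annulusKernel hR hd (by linarith)
  have i1 := (integrable_radial_areaOn hΩ h1 z').const_mul M
  have i2 := (integrable_radial_areaOn hΩ h1 z).const_mul M
  have i3 := (integrable_radial_areaOn hΩ h3 z).const_mul (M * K * logScale R d ^ (-ν))
  have h5 := norm_integral_le_of_norm_le ((i1.add i2).add i3) (Filter.Eventually.of_forall hpt)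
  rw [integral_add' (i1.add i2) i3, integral_add' i1 i2, integral_const_mul, integral_const_mul,
    integral_const_mul, integral_sub (integrable_nwIntegrand hΩ hν hR hM hD hc hf z')
      (integrable_nwIntegrand hΩ hν hR hM hD hc hf z)] at h5
  have h6 := (integral_radial_areaOn_le hΩ h1 (discKernel_nonneg hR hρ) z').trans_eq h2
  have h7 := (integral_radial_areaOn_le hΩ h1 (discKernel_nonneg hR hρ) z).trans_eq h2
  have h8 := (integral_radial_areaOn_le hΩ h3 (annulusKernel_nonneg hd.le) z).trans h4
  have h9 := logScale_rpow_neg_three_mul_le hν'.le hR hd hρ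
  rw [neg_sub] at h9 ⊢
  have hK : 0 ≤ K := by positivity
  have hl' : 0 ≤ logScale R d := by linarith
  have h10 : logScale R d ^ (-ν) * logScale R d = logScale R d ^ (1 - ν) := by
    rw [← Real.rpow_add_one (by linarith)]
    ring_nf
  rw [nijenhuisWoolf_eq, nijenhuisWoolf_eq, ← mul_sub, norm_mul, norm_neg, norm_inv,
    Complex.norm_real, Real.norm_of_nonneg Real.pi_pos.le]
  have hdisc : 2 * Real.pi * (logScale R (3 * d) ^ (1 - ν) / (ν - 1)) ≤
      2 * Real.pi * (3 ^ (ν - 1) * logScale R d ^ (1 - ν) / (ν - 1)) := by gcongr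
  calc _ ≤ Real.pi⁻¹ * (M * (2 * Real.pi * (3 ^ (ν - 1) * logScale R d ^ (1 - ν) / (ν - 1))) +
        M * (2 * Real.pi * (3 ^ (ν - 1) * logScale R d ^ (1 - ν) / (ν - 1))) +
        M * K * logScale R d ^ (-ν) * (2 * Real.pi * logScale R d)) := by
        refine mul_le_mul_of_nonneg_left (h5.trans ?_) (by positivity)
        gcongr
        · exact h6.trans hdisc
        · exact h7.trans hdisc
    _ = 4 * 3 ^ (ν - 1) / (ν - 1) * M * logScale R d ^ (1 - ν) +
        2 * K * M * (logScale R d ^ (-ν) * logScale R d) := by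
        field_simp
        ring
    _ = _ := by rw [h10]; ring

/-- A modulus of continuity in terms of the scale gives membership in the logarithmic space. -/
theorem mem_logSubmodule_of_bounds {p C : ℝ} {g : Ω → ℂ} (hp : 0 < p) (hR : 1 ≤ R) (hC : 0 ≤ C)
    (hD : ∀ w w' : Ω, 3 * ‖(w' : ℂ) - w‖ ≤ R) (hsup : ∀ w, ‖g w‖ ≤ C)
    (hg : ∀ w w' : Ω, w ≠ w' → ‖g w' - g w‖ ≤ C * logScale R ‖(w' : ℂ) - w‖ ^ (-p)) :
    Continuous g ∧ eLogNorm p g ≤ ENNReal.ofReal (2 * C) := by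
  constructor
  · rw [continuous_iff_continuousAt]
    intro w
    rw [← continuousWithinAt_compl_self, ContinuousWithinAt, tendsto_iff_norm_sub_tendsto_zero]
    have h1 : Filter.Tendsto (fun w' : Ω => ‖(w' : ℂ) - w‖) (nhdsWithin w {w}ᶜ)
        (nhdsWithin 0 (Ioi 0)) := by
      refine tendsto_nhdsWithin_iff.2 ⟨?_, ?_⟩
      · have : Continuous fun w' : Ω => ‖(w' : ℂ) - w‖ := by fun_prop
        simpa using (this.tendsto w).mono_left nhdsWithin_le_nhds
      · filter_upwards [self_mem_nhdsWithin] with w' hw'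
        exact norm_pos_iff.2 (sub_ne_zero.2 fun h => hw' (Subtype.ext h))
    have h2 := ((tendsto_logScale_rpow hp hR).comp h1).const_mul C
    rw [mul_zero] at h2
    refine squeeze_zero' (Filter.Eventually.of_forall fun _ => norm_nonneg _) ?_ h2
    filter_upwards [self_mem_nhdsWithin] with w' hw'
    exact hg w w' (Ne.symm hw')
  · rw [two_mul, ENNReal.ofReal_add hC hC, eLogNorm]
    refine add_le_add (iSup_le fun w => ?_) (iSup_le fun w => iSup_le fun w' => ?_)
    · rw [← ofReal_norm]
      exact ENNReal.ofReal_le_ofReal (hsup w)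
    · rw [← ofReal_norm, ← ENNReal.ofReal_mul (norm_nonneg _)]
      refine ENNReal.ofReal_le_ofReal ?_
      rcases eq_or_ne w w' with rfl | hne
      · simpa using hC
      have ht : 0 < ‖(w' : ℂ) - w‖ :=
        norm_pos_iff.2 (sub_ne_zero.2 fun h => hne (Subtype.ext h.symm))
      have htR : ‖(w' : ℂ) - w‖ ≤ R := by linarith [hD w w']
      have hl := one_le_logScale hR ht htR
      have hl' : 0 ≤ logScale R ‖(w' : ℂ) - w‖ := by linarith
      calc _ ≤ C * logScale R ‖(w' : ℂ) - w‖ ^ (-p) * logScale R ‖(w' : ℂ) - w‖ ^ p := by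
            gcongr
            · exact hg w w' hne
            · exact abs_log_le_logScale hR ht htR
        _ = C := by
            rw [mul_assoc, ← Real.rpow_add (by linarith), neg_add_cancel, Real.rpow_zero, mul_one]

end Estimates

/-! ### Linearity and boundedness -/

theorem nijenhuisWoolf_add {f g : Ω → ℂ} {z : Ω} (hf : Integrable (nwIntegrand f z) (areaOn Ω))
    (hg : Integrable (nwIntegrand g z) (areaOn Ω)) :
    nijenhuisWoolf (f + g) z = nijenhuisWoolf f z + nijenhuisWoolf g z := by
  rw [nijenhuisWoolf_eq, nijenhuisWoolf_eq, nijenhuisWoolf_eq, ← mul_add, ← integral_add hf hg]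
  congr 1
  refine integral_congr_ae (Filter.Eventually.of_forall fun ζ => ?_)
  simp only [nwIntegrand, Pi.add_apply]
  ring

theorem nijenhuisWoolf_smul (c : ℂ) (f : Ω → ℂ) (z : Ω) :
    nijenhuisWoolf (c • f) z = c * nijenhuisWoolf f z := by
  rw [nijenhuisWoolf_eq, nijenhuisWoolf_eq, mul_left_comm, ← integral_const_mul c]
  congr 1
  refine integral_congr_ae (Filter.Eventually.of_forall fun ζ => ?_)
  simp only [nwIntegrand, Pi.smul_apply, smul_eq_mul]
  ring

theorem mainTheorem2 (Ω : Set ℂ) (hΩ_open : IsOpen Ω) (hΩ_conn : IsConnected Ω)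
    (hΩ_bdd : Bornology.IsBounded Ω) (α : ℝ≥0) (hα : 0 < α)
    (hΩ_bdry : HasC1HolderBoundary Ω α) (ν : ℝ) (hν : 1 < ν) :
    ∃ L : LogCont Ω ν →L[ℂ] LogCont Ω (ν - 1), ∀ (f : LogCont Ω ν) (z : Ω),
      MeasureTheory.Integrable (nwIntegrand f z) (areaOn Ω) ∧ L f z = nijenhuisWoolf f z := by
  have hΩ := hΩ_open.measurableSet
  have hν' : 0 < ν - 1 := by linarith
  obtain ⟨R, hR, hD⟩ : ∃ R : ℝ, 1 ≤ R ∧ ∀ w w' : Ω, 3 * ‖(w' : ℂ) - w‖ ≤ R := by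
    obtain ⟨D, hD⟩ := Metric.isBounded_iff.1 hΩ_bdd
    refine ⟨max 1 (3 * D), le_max_left _ _, fun w w' => le_max_of_le_right ?_⟩
    have h := hD w'.2 w.2
    rw [dist_eq_norm] at h
    linarith
  have hlogR := Real.log_nonneg hR
  set A := 2 * (2 + 2 * Real.log R) ^ ν
  have hA : 0 ≤ A := by positivity
  have hmod : ∀ (f : LogCont Ω ν) (w w' : Ω), w ≠ w' →
      ‖f w' - f w‖ ≤ A * ‖f‖ * logScale R ‖(w' : ℂ) - w‖ ^ (-ν) := fun f w w' hne =>
    norm_sub_le_logScale (by linarith) hR f hne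
      (by linarith [hD w w', norm_nonneg ((w' : ℂ) - w)])
  have hint : ∀ (f : LogCont Ω ν) (z : Ω), Integrable (nwIntegrand f z) (areaOn Ω) :=
    fun f => integrable_nwIntegrand hΩ hν hR (by positivity) hD f.2.1 (hmod f)
  set B := 2 / (ν - 1) + (4 * 3 ^ (ν - 1) / (ν - 1) + 2 * (10 * (1 + ν) ^ ν + 4))
  have hB1 : 2 / (ν - 1) ≤ B := le_add_of_nonneg_right (by positivity)
  have hB2 : 4 * 3 ^ (ν - 1) / (ν - 1) + 2 * (10 * (1 + ν) ^ ν + 4) ≤ B :=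
    le_add_of_nonneg_left (by positivity)
  have hB : 0 ≤ B := le_trans (by positivity) hB1
  have hT : ∀ f : LogCont Ω ν, Continuous (nijenhuisWoolf f) ∧
      eLogNorm (ν - 1) (nijenhuisWoolf f) ≤ ENNReal.ofReal (2 * (B * (A * ‖f‖))) := by
    intro f
    refine mem_logSubmodule_of_bounds hν' hR (by positivity) hD (fun z => ?_) fun z z' hne => ?_
    · exact (norm_nijenhuisWoolf_le hΩ hν hR (by positivity) hD (hmod f) z).trans (by gcongr)
    · have h1 := one_le_logScale hR (norm_pos_iff.2 (sub_ne_zero.2 fun h =>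
        hne (Subtype.ext h.symm))) (by linarith [hD z z', norm_nonneg ((z' : ℂ) - z)] :
          ‖(z' : ℂ) - z‖ ≤ R)
      have h2 : 0 ≤ logScale R ‖(z' : ℂ) - z‖ := by linarith
      exact (norm_nijenhuisWoolf_sub_le hΩ hν hR (by positivity) hD f.2.1 (hmod f) hne).trans
        (by gcongr)
  let L₀ : LogCont Ω ν →ₗ[ℂ] LogCont Ω (ν - 1) :=
    { toFun := fun f => ⟨nijenhuisWoolf f, (hT f).1, (hT f).2.trans_lt ENNReal.ofReal_lt_top⟩
      map_add' := fun f g => Subtype.ext (funext fun z => nijenhuisWoolf_add (hint f z) (hint g z))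
      map_smul' := fun c f => Subtype.ext (funext fun z => nijenhuisWoolf_smul c f z) }
  refine ⟨L₀.mkContinuous (2 * (B * A)) fun f => ?_, fun f z => ⟨hint f z, rfl⟩⟩
  rw [LogCont.norm_def]
  refine ENNReal.toReal_le_of_le_ofReal (by positivity) ((hT f).2.trans_eq ?_)
  congr 1
  ring
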